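/- All rings are commutative with $1$. Let $\varphi\colon A\to B$ be a crisp ring homomorphism, i.e. one for which the map $\varphi\otimes\mathrm{id}_P\colon A\otimes_A P\to B\otimes_A P$ is injective for every $A$-module $P$ (such homomorphisms are also called pure, or universally injective). Let $R$ be an $A$-algebra. Then: 1. if $R\otimes_A B$ is a formally unramified $B$-algebra, then $R$ is a formally unramified $A$-algebra; 2. if $R\otimes_A B$ is an unramified $B$-algebra, then $R$ is an unramified $A$-algebra; 3. if $R\otimes_A B$ is an étale $B$-algebra, then $R$ is an étale $A$-algebra; 4. if $R\otimes_A B$ is a smooth $B$-algebra, then $R$ is a smooth $A$-algebra. Here unramified means formally unramified and of finite type, étale means formally étale and of finite presentation, and smooth means formally smooth and of finite presentation. -/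

import Mathlib

open scoped TensorProduct

universe u v w

/-- A linear map `f : M → N` of `A`-modules is *crisp* (pure, universally injective) if
`f ⊗ id : M ⊗[A] P → N ⊗[A] P` is injective for all `A`-modules `P`.
Modules `P` in the universe of `A` suffice: see `IsCrispMap.rTensor_injective`, which
gives the injectivity for `A`-modules `P` in an arbitrary universe. -/
def IsCrispMap {A : Type u} [CommRing A] {M : Type v} {N : Type w}
    [AddCommGroup M] [Module A M] [AddCommGroup N] [Module A N] (f : M →ₗ[A] N) : Prop :=
  ∀ (P : Type u) [AddCommGroup P] [Module A P], Function.Injective (f.rTensor P)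

/-- An algebra `B` over `A` (that is, the ring homomorphism `A → B`) is *crisp* if `A → B` is
crisp as a map of `A`-modules. -/
def IsCrispAlgebra (A : Type u) (B : Type v) [CommRing A] [CommRing B] [Algebra A B] : Prop :=
  IsCrispMap (Algebra.linearMap A B)

/-- The choice of universe in `IsCrispMap` is immaterial. -/
theorem IsCrispMap.rTensor_injective {A : Type u} [CommRing A] {M : Type v} {N : Type w}
    [AddCommGroup M] [Module A M] [AddCommGroup N] [Module A N] {f : M →ₗ[A] N}
    (hf : IsCrispMap f) (P : Type*) [AddCommGroup P] [Module A P] :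
    Function.Injective (f.rTensor P) := by
  rw [← LinearMap.lTensor_inj_iff_rTensor_inj, injective_iff_map_eq_zero]
  intro x hx
  obtain ⟨Q, hQ, t, rfl⟩ := TensorProduct.exists_of_fg x
  have h0 : LinearMap.rTensor N Q.subtype (f.lTensor Q t) = LinearMap.rTensor N Q.subtype 0 := by
    rw [map_zero, ← hx, ← LinearMap.comp_apply, ← LinearMap.comp_apply,
      LinearMap.rTensor_comp_lTensor, LinearMap.lTensor_comp_rTensor]
  obtain ⟨Q', hQQ', hQ', h1⟩ := TensorProduct.eq_of_fg_of_subtype_eq hQ h0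
  have : Small.{u} Q' := Submodule.FG.small Q' hQ'
  let e : Shrink.{u} Q' ≃ₗ[A] Q' := Shrink.linearEquiv A Q'
  have hinj : Function.Injective (f.lTensor Q') := by
    have h2 := (LinearMap.lTensor_inj_iff_rTensor_inj (Shrink.{u} Q') f).2 (hf (Shrink.{u} Q'))
    have h3 : f.lTensor Q' =
        (e.rTensor N).toLinearMap ∘ₗ f.lTensor (Shrink.{u} Q') ∘ₗ
          (e.symm.rTensor M).toLinearMap := by
      ext a b
      simp
    rw [h3]
    exact (e.rTensor N).injective.comp (h2.comp (e.symm.rTensor M).injective)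
  have h4 : (Submodule.inclusion hQQ').rTensor M t = 0 := by
    apply hinj
    rw [map_zero, ← LinearMap.comp_apply, LinearMap.lTensor_comp_rTensor,
      ← LinearMap.rTensor_comp_lTensor, LinearMap.comp_apply, h1, map_zero]
  have h5 : Q.subtype = Q'.subtype ∘ₗ Submodule.inclusion hQQ' := by
    ext
    rfl
  rw [h5, LinearMap.rTensor_comp, LinearMap.comp_apply, h4, map_zero]

open MvPolynomial

attribute [local instance] MvPolynomial.algebraMvPolynomial

namespace IsCrispAlgebra

/-! ### Module properties detected after a crisp base change. -/

section Module

variable {A : Type u} {B : Type v} [CommRing A] [CommRing B] [Algebra A B]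

/-! Crispness embeds every `A`-module in its base change, so vanishing of a module, surjectivity of
a linear map and membership in a submodule can all be tested over `B`. This settles `Ω[R⁄A] = 0` and
finite type directly; finite presentation follows because polynomial rings inherit crispness and
ideals are contracted from their extensions. Formal smoothness asks for a lift, so it is first made
a membership statement. If `R = P/I` with `I = (F_j)` and `P` a polynomial ring, sections of `P/I² →
R` correspond to substitutions `X_i ↦ X_i - p_i`, `p_i ∈ I`, killing each `F_j` modulo `I²`. By
Taylor expansion this is linear in `p`, and says that the vector `F` lies in `firstOrderSubmodule I
F`, which descends by contraction. -/

/-- Along a crisp algebra, every module embeds into its base change. -/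
theorem one_tmul_injective (hAB : IsCrispAlgebra A B) (M : Type*) [AddCommGroup M] [Module A M] :
    Function.Injective fun m : M ↦ (1 : B) ⊗ₜ[A] m := by
  have h := (IsCrispMap.rTensor_injective hAB M).comp (TensorProduct.lid A M).symm.injective
  convert h using 2 with m
  simp

/-- An algebra is crisp if every module embeds into its base change. -/
theorem of_one_tmul_injective
    (h : ∀ (M : Type u) [AddCommGroup M] [Module A M],
      Function.Injective fun m : M ↦ (1 : B) ⊗ₜ[A] m) :
    IsCrispAlgebra A B := by
  intro M _ _
  have h' := (h M).comp (TensorProduct.lid A M).injective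
  have he : ⇑((Algebra.linearMap A B).rTensor M) =
      (fun m : M ↦ (1 : B) ⊗ₜ[A] m) ∘ TensorProduct.lid A M := by
    ext x
    induction x with
    | zero => simp
    | add x y hx hy => simp_all [TensorProduct.tmul_add]
    | tmul a m => simp [Algebra.algebraMap_eq_smul_one, TensorProduct.smul_tmul]
  rwa [he]

/-- Crisp algebras are stable under base change. -/
theorem of_isPushout (hAB : IsCrispAlgebra A B) (A' : Type w) (B' : Type*) [CommRing A'] [CommRing B']
    [Algebra A A'] [Algebra A B'] [Algebra A' B'] [Algebra B B'] [IsScalarTower A A' B']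
    [IsScalarTower A B B'] [Algebra.IsPushout A B A' B'] : IsCrispAlgebra A' B' := by
  refine of_one_tmul_injective fun M _ _ ↦ ?_
  let _ : Module A M := Module.compHom M (algebraMap A A')
  have : IsScalarTower A A' M := .of_algebraMap_smul fun _ _ ↦ rfl
  refine Function.Injective.of_comp (f := Algebra.IsPushout.cancelBaseChange A B A' B' M) ?_
  convert hAB.one_tmul_injective M using 2 with m
  simp

theorem mvPolynomial (hAB : IsCrispAlgebra A B) (σ : Type*) :
    IsCrispAlgebra (MvPolynomial σ A) (MvPolynomial σ B) :=
  hAB.of_isPushout _ _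

theorem subsingleton_of_tensorProduct (hAB : IsCrispAlgebra A B) (M : Type*) [AddCommGroup M]
    [Module A M] [Subsingleton (B ⊗[A] M)] : Subsingleton M :=
  (hAB.one_tmul_injective M).subsingleton

theorem surjective_of_lTensor (hAB : IsCrispAlgebra A B) {M N : Type*} [AddCommGroup M]
    [Module A M] [AddCommGroup N] [Module A N] (f : M →ₗ[A] N)
    (hf : Function.Surjective (f.lTensor B)) : Function.Surjective f := by
  intro n
  obtain ⟨y, hy⟩ := hf (1 ⊗ₜ n)
  have h0 : (1 : B) ⊗ₜ[A] (LinearMap.range f).mkQ n = 1 ⊗ₜ 0 := by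
    rw [← LinearMap.lTensor_tmul, ← hy, ← LinearMap.comp_apply, ← LinearMap.lTensor_comp,
      LinearMap.range_mkQ_comp]
    simp
  simpa using hAB.one_tmul_injective _ h0

/-- Submodules are contracted from their extensions along a crisp base change. -/
theorem mem_of_mem_span_image (hAB : IsCrispAlgebra A B) {M M' : Type*} [AddCommGroup M]
    [Module A M] [AddCommGroup M'] [Module A M'] [Module B M'] [IsScalarTower A B M']
    {j : M →ₗ[A] M'} (hj : IsBaseChange B j) {W : Submodule A M} {t : M}
    (ht : j t ∈ Submodule.span B (j '' W)) : t ∈ W := by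
  -- The base change of `M → M ⧸ W`; it kills the extension of `W`.
  let q : M' →ₗ[B] B ⊗[A] (M ⧸ W) := hj.lift (TensorProduct.mk A B (M ⧸ W) 1 ∘ₗ W.mkQ)
  have hq (m : M) : q (j m) = 1 ⊗ₜ W.mkQ m := hj.lift_eq _ m
  have hle : Submodule.span B (j '' W) ≤ LinearMap.ker q := by
    rw [Submodule.span_le]
    rintro _ ⟨w, hw, rfl⟩
    simp [hq, (Submodule.Quotient.mk_eq_zero W).mpr hw]
  have h0 : (1 : B) ⊗ₜ[A] W.mkQ t = 1 ⊗ₜ 0 := by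
    rw [← hq, LinearMap.mem_ker.mp (hle ht), TensorProduct.tmul_zero]
  simpa using hAB.one_tmul_injective _ h0

theorem mem_of_algebraMap_mem_map (hAB : IsCrispAlgebra A B) {I : Ideal A} {a : A}
    (ha : algebraMap A B a ∈ I.map (algebraMap A B)) : a ∈ I :=
  hAB.mem_of_mem_span_image (IsBaseChange.linearMap A B) ha

/-- Finite generation of ideals descends along crisp algebras. -/
theorem fg_of_fg_map (hAB : IsCrispAlgebra A B) {I : Ideal A}
    (hI : (I.map (algebraMap A B)).FG) : I.FG := by
  classical
  -- Finitely many images of elements of `I` already generate the extension; contraction then shows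
  -- that these elements generate `I`.
  obtain ⟨s, hs, hspan⟩ := (Submodule.fg_span_iff_fg_span_finset_subset _).mp hI
  obtain ⟨t, ht, rfl⟩ := Finset.subset_set_image_iff.mp hs
  refine ⟨t, le_antisymm (Submodule.span_le.mpr ht) fun a ha ↦ ?_⟩
  refine hAB.mem_of_algebraMap_mem_map (I := Ideal.span t) ?_
  rw [Ideal.map_span, ← Finset.coe_image]
  exact hspan.le (Submodule.subset_span ⟨a, ha, rfl⟩)

end Module

end IsCrispAlgebra

namespace MvPolynomial

/-! ### Presentations under base change, and Taylor expansion. -/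

section Kernel

variable {A R σ : Type*} [CommRing A] [CommRing R] [Algebra A R] (B : Type*) [CommRing B]
  [Algebra A B]

/-- The base change of a homomorphism out of a polynomial ring. -/
noncomputable def baseChangeHom (f : MvPolynomial σ A →ₐ[A] R) :
    MvPolynomial σ B →ₐ[B] B ⊗[A] R :=
  (Algebra.TensorProduct.map (AlgHom.id B B) f).comp (algebraTensorAlgEquiv A B).symm.toAlgHom

theorem baseChangeHom_surjective {f : MvPolynomial σ A →ₐ[A] R} (hf : Function.Surjective f) :
    Function.Surjective (baseChangeHom B f) :=
  (Algebra.FiniteType.baseChangeAux_surj B hf).comp (algebraTensorAlgEquiv A B).symm.surjective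

/-- This is right exactness of the tensor product, moved to `MvPolynomial σ B`. -/
theorem ker_baseChangeHom {f : MvPolynomial σ A →ₐ[A] R} (hf : Function.Surjective f) :
    RingHom.ker (baseChangeHom B f).toRingHom =
      (RingHom.ker f.toRingHom).map (algebraMap (MvPolynomial σ A) (MvPolynomial σ B)) := by
  have h : RingHom.ker (Algebra.TensorProduct.map (AlgHom.id B B) f) =
      (RingHom.ker f).map Algebra.TensorProduct.includeRight :=
    Algebra.TensorProduct.lTensor_ker f hf
  apply le_antisymm
  · intro p hp
    have hp' : (algebraTensorAlgEquiv A B).symm p ∈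
        RingHom.ker (Algebra.TensorProduct.map (AlgHom.id B B) f) := hp
    rw [h] at hp'
    have := Ideal.mem_map_of_mem (algebraTensorAlgEquiv (σ := σ) A B) hp'
    rw [AlgEquiv.apply_symm_apply] at this
    refine SetLike.le_def.mp ?_ this
    rw [Ideal.map_le_iff_le_comap, Ideal.map_le_iff_le_comap]
    intro x hx
    have hx' := Ideal.mem_map_of_mem (algebraMap (MvPolynomial σ A) (MvPolynomial σ B)) hx
    rw [MvPolynomial.algebraMap_def] at hx'
    simpa using! hx'
  · rw [Ideal.map_le_iff_le_comap]
    intro x hx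
    have hx' : f x = 0 := hx
    simp [baseChangeHom, hx']

end Kernel

section Taylor

variable {A σ : Type*} [CommRing A] [Fintype σ]

/-- The first order Taylor expansion of a polynomial, exact up to a square-zero ideal. -/
theorem aeval_sub_of_mul_eq_zero {C : Type*} [CommRing C] [Algebra A C] (x r : σ → C)
    (hr : ∀ i j, r i * r j = 0) (q : MvPolynomial σ A) :
    aeval (x - r) q = aeval x q - ∑ i, aeval x (pderiv i q) * r i := by
  classical
  induction q using MvPolynomial.induction_on with
  | C a => simp
  | add p q hp hq =>
    simp only [map_add, hp, hq, add_mul, Finset.sum_add_distrib]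
    ring
  | mul_X p k hp =>
    have h0 : (∑ i, aeval x (pderiv i p) * r i) * r k = 0 := by
      simp [Finset.sum_mul, mul_assoc, hr]
    have h1 : ∑ i, aeval x (pderiv i (p * X k)) * r i =
        aeval x p * r k + (∑ i, aeval x (pderiv i p) * r i) * x k := by
      simp only [Derivation.leibniz, pderiv_X, smul_eq_mul, map_add, map_mul, aeval_X, add_mul,
        Finset.sum_add_distrib, Finset.sum_mul]
      congr 1
      · rw [Finset.sum_eq_single k]
        · simp
        · intro i _ hi
          simp [hi.symm]
        · simp
      · exact Finset.sum_congr rfl fun i _ ↦ by ring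
    rw [h1, map_mul, hp, map_mul, aeval_X, aeval_X, Pi.sub_apply]
    linear_combination h0

end Taylor

end MvPolynomial

/-! ### The linear Jacobian criterion. -/

section Criterion

variable {A R σ ι : Type*} [CommRing A] [CommRing R] [Algebra A R]

/-- The vectors that a first order change of the variables by elements of `I` can reach modulo
`I ^ 2` from the family `F` of polynomials. -/
noncomputable def firstOrderSubmodule (I : Ideal (MvPolynomial σ A)) (F : ι → MvPolynomial σ A) :
    Submodule (MvPolynomial σ A) (ι → MvPolynomial σ A) :=
  I • Submodule.span _ (Set.range fun i j ↦ pderiv i (F j)) ⊔ I ^ 2 • ⊤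

variable [Fintype σ] [Fintype ι]

theorem mem_firstOrderSubmodule_iff {I : Ideal (MvPolynomial σ A)}
    {F G : ι → MvPolynomial σ A} :
    G ∈ firstOrderSubmodule I F ↔
      ∃ p : σ → MvPolynomial σ A, (∀ i, p i ∈ I) ∧
        ∀ j, G j - ∑ i, pderiv i (F j) * p i ∈ I ^ 2 := by
  classical
  constructor
  · intro h
    obtain ⟨y, hy, z, hz, rfl⟩ := Submodule.mem_sup.mp h
    obtain ⟨a, ha, rfl⟩ := (Submodule.mem_ideal_smul_span_iff_exists_sum _ _ _).mp hy
    refine ⟨a, ha, fun j ↦ ?_⟩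
    have hzj : z j ∈ I ^ 2 := by
      refine Submodule.smul_induction_on hz (fun r hr n _ ↦ ?_) fun x y hx hy ↦ ?_
      · exact Ideal.mul_mem_right _ _ hr
      · exact add_mem hx hy
    rw [Finsupp.sum_fintype _ _ (by simp)]
    simpa [mul_comm] using hzj
  · rintro ⟨p, hp, hG⟩
    have hsplit : G = ∑ i, p i • (fun j ↦ pderiv i (F j)) +
        ∑ j, (G j - ∑ i, pderiv i (F j) * p i) • Pi.single j 1 := by
      ext1 k
      simp [Finset.sum_apply, Pi.single_apply, mul_comm]
    rw [hsplit]
    refine Submodule.add_mem_sup (Submodule.sum_mem _ fun i _ ↦ ?_)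
      (Submodule.sum_mem _ fun j _ ↦ ?_)
    · exact Submodule.smul_mem_smul (hp i) (Submodule.subset_span ⟨i, rfl⟩)
    · exact Submodule.smul_mem_smul (hG j) trivial

/-- The Jacobian criterion in its linear form: formal smoothness of a quotient of a polynomial ring
by finitely many polynomials is solvability of a system of linear equations. -/
theorem Algebra.FormallySmooth.iff_mem_firstOrderSubmodule (f : MvPolynomial σ A →ₐ[A] R)
    (hf : Function.Surjective f) (F : ι → MvPolynomial σ A)
    (hF : Ideal.span (Set.range F) = RingHom.ker f.toRingHom) :
    Algebra.FormallySmooth A R ↔ F ∈ firstOrderSubmodule (RingHom.ker f.toRingHom) F := by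
  rw [Algebra.FormallySmooth.iff_split_surjection f hf, mem_firstOrderSubmodule_iff]
  set I := RingHom.ker f.toRingHom with hI
  let π : MvPolynomial σ A →ₐ[A] MvPolynomial σ A ⧸ I ^ 2 := Ideal.Quotient.mkₐ A _
  have hπ : Function.Surjective π := Ideal.Quotient.mkₐ_surjective A _
  have hπ0 (q) : π q = 0 ↔ q ∈ I ^ 2 := Ideal.Quotient.eq_zero_iff_mem
  have hfπ (q) : f.kerSquareLift (π q) = f q := rfl
  have hfF (j) : f (F j) = 0 := by
    have : F j ∈ I := hF ▸ Ideal.subset_span ⟨j, rfl⟩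
    exact this
  have taylor (p : σ → MvPolynomial σ A) (hp : ∀ i, p i ∈ I) (q : MvPolynomial σ A) :
      aeval (fun i ↦ π (X i - p i)) q = π (q - ∑ i, pderiv i q * p i) := by
    have hx (q) : aeval (fun i ↦ π (X i)) q = π q := by
      rw [← comp_aeval_apply, aeval_X_left_apply]
    have := aeval_sub_of_mul_eq_zero (A := A) (fun i ↦ π (X i)) (fun i ↦ π (p i))
      (fun i j ↦ by
        rw [← map_mul, hπ0, pow_two]
        exact Ideal.mul_mem_mul (hp i) (hp j)) q
    simp only [hx] at this
    simp only [map_sub, map_sum, map_mul]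
    exact this
  constructor
  · rintro ⟨g, hg⟩
    have hg' (r) : f.kerSquareLift (g r) = r := DFunLike.congr_fun hg r
    -- `p i` measures how far the section `g` moves `X i` modulo `I ^ 2`.
    choose p hp using fun i ↦ hπ (π (X i) - g (f (X i)))
    have hpI (i) : p i ∈ I := by
      change f (p i) = 0
      rw [← hfπ, hp, map_sub, hg', hfπ, sub_self]
    refine ⟨p, hpI, fun j ↦ ?_⟩
    have hgf : g.comp f = aeval fun i ↦ π (X i - p i) := by
      ext i
      rw [AlgHom.comp_apply, aeval_X, map_sub, hp, sub_sub_cancel]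
    rw [← hπ0, ← taylor p hpI, ← hgf, AlgHom.comp_apply, hfF, map_zero]
  · rintro ⟨p, hp, hpF⟩
    let h : MvPolynomial σ A →ₐ[A] MvPolynomial σ A ⧸ I ^ 2 := aeval fun i ↦ π (X i - p i)
    have hker : RingHom.ker f.toRingHom ≤ RingHom.ker h.toRingHom := by
      refine hF.ge.trans (Ideal.span_le.mpr ?_)
      rintro _ ⟨j, rfl⟩
      exact (taylor p hp (F j)).trans ((hπ0 _).mpr (hpF j))
    refine ⟨f.liftOfSurjective hf h hker, ?_⟩
    have hcomp : f.kerSquareLift.comp h = f := by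
      ext i
      have : f (p i) = 0 := hp i
      rw [AlgHom.comp_apply, aeval_X, hfπ, map_sub, this, sub_zero]
    ext r
    obtain ⟨q, rfl⟩ := hf r
    rw [AlgHom.comp_apply, AlgHom.liftOfSurjective_apply, ← AlgHom.comp_apply, hcomp]
    rfl

/-- Partial derivatives commute with base change, so the left side is spanned by images of elements
of `firstOrderSubmodule I F`. -/
theorem firstOrderSubmodule_map_le {A σ ι B : Type*} [CommRing A] [CommRing B] [Algebra A B]
    [Finite ι]
    (I : Ideal (MvPolynomial σ A)) (F : ι → MvPolynomial σ A) :
    firstOrderSubmodule (I.map (algebraMap (MvPolynomial σ A) (MvPolynomial σ B)))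
        (fun j ↦ algebraMap (MvPolynomial σ A) (MvPolynomial σ B) (F j)) ≤
      Submodule.span (MvPolynomial σ B)
        ((Algebra.linearMap (MvPolynomial σ A) (MvPolynomial σ B)).compLeft ι ''
          firstOrderSubmodule I F) := by
  classical
  have := Fintype.ofFinite ι
  refine sup_le ?_ ?_
  · rw [Ideal.map, Submodule.span_smul_span, Submodule.span_le]
    rintro _ ⟨_, ⟨b, hb, rfl⟩, _, ⟨i, rfl⟩, rfl⟩
    refine Submodule.subset_span ⟨b • fun j ↦ pderiv i (F j), ?_, ?_⟩
    · exact Submodule.mem_sup_left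
        (Submodule.smul_mem_smul hb (Submodule.subset_span ⟨i, rfl⟩))
    · ext1 j
      simp [pderiv_map]
  · rw [← Ideal.map_pow, Ideal.map, ← (Pi.basisFun (MvPolynomial σ B) ι).span_eq,
      Submodule.span_smul_span, Submodule.span_le]
    rintro _ ⟨_, ⟨b, hb, rfl⟩, _, ⟨i, rfl⟩, rfl⟩
    refine Submodule.subset_span ⟨b • Pi.single i 1, ?_, ?_⟩
    · exact Submodule.mem_sup_right (Submodule.smul_mem_smul hb trivial)
    · ext1 j
      by_cases h : j = i <;> simp [h]

end Criterion

/-! ### Descent of algebra properties. -/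

namespace IsCrispAlgebra

variable {A B R : Type*} [CommRing A] [CommRing B] [CommRing R] [Algebra A B] [Algebra A R]

theorem formallyUnramified (hAB : IsCrispAlgebra A B)
    [Algebra.FormallyUnramified B (B ⊗[A] R)] : Algebra.FormallyUnramified A R := by
  let _ : Algebra R (B ⊗[A] R) := Algebra.TensorProduct.rightAlgebra
  have : Subsingleton (B ⊗[A] Ω[R⁄A]) :=
    (KaehlerDifferential.tensorKaehlerEquivBase A B R (B ⊗[A] R)).subsingleton
  exact ⟨hAB.subsingleton_of_tensorProduct _⟩

theorem finiteType (hAB : IsCrispAlgebra A B)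
    [Algebra.FiniteType B (B ⊗[A] R)] : Algebra.FiniteType A R := by
  obtain ⟨s, hs⟩ := Algebra.FiniteType.out (R := B) (A := B ⊗[A] R)
  -- The right-hand factors `m` of the generators will generate `R`, by descent of surjectivity.
  choose k t m h using fun x : s ↦ TensorProduct.exists_sum_tmul_eq x.1
  let f : MvPolynomial (Σ x : s, Fin (k x)) A →ₐ[A] R := aeval fun x ↦ m x.1 x.2
  apply Algebra.FiniteType.of_surjective f
  have hf : Function.Surjective (Algebra.TensorProduct.map (.id B B) f) := by
    rw [← AlgHom.range_eq_top, _root_.eq_top_iff, ← hs, Algebra.adjoin_le_iff]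
    intro x hx
    use ∑ j : Fin (k ⟨x, hx⟩), t ⟨x, hx⟩ j ⊗ₜ X ⟨⟨x, hx⟩, j⟩
    simp [f, ← h]
  exact hAB.surjective_of_lTensor f.toLinearMap hf

theorem finitePresentation (hAB : IsCrispAlgebra A B)
    [Algebra.FinitePresentation B (B ⊗[A] R)] : Algebra.FinitePresentation A R := by
  obtain ⟨n, f, hf⟩ := Algebra.FiniteType.iff_quotient_mvPolynomial''.mp (hAB.finiteType (R := R))
  refine .of_surjective hf ((hAB.mvPolynomial (Fin n)).fg_of_fg_map ?_)
  rw [← ker_baseChangeHom B hf]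
  exact Algebra.FinitePresentation.ker_fG_of_surjective _ (baseChangeHom_surjective B hf)

theorem formallySmooth (hAB : IsCrispAlgebra A B) [Algebra.FinitePresentation A R]
    [Algebra.FormallySmooth B (B ⊗[A] R)] : Algebra.FormallySmooth A R := by
  obtain ⟨n, f, hf, s, hs⟩ := Algebra.FinitePresentation.out (R := A) (A := R)
  let F : s → MvPolynomial (Fin n) A := (↑)
  have hF : Ideal.span (Set.range F) = RingHom.ker f.toRingHom := by
    rw [← hs, Subtype.range_coe_subtype]
    rfl
  let F' : s → MvPolynomial (Fin n) B := fun j ↦ algebraMap _ _ (F j)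
  have hF' : Ideal.span (Set.range F') = RingHom.ker (baseChangeHom B f).toRingHom := by
    rw [ker_baseChangeHom B hf, ← hF, Ideal.map_span, ← Set.range_comp]
    rfl
  rw [Algebra.FormallySmooth.iff_mem_firstOrderSubmodule f hf F hF]
  refine (hAB.mvPolynomial (Fin n)).mem_of_mem_span_image
    ((IsBaseChange.linearMap _ _).finitePow s) ?_
  apply firstOrderSubmodule_map_le
  rw [← ker_baseChangeHom B hf]
  exact (Algebra.FormallySmooth.iff_mem_firstOrderSubmodule _ (baseChangeHom_surjective B hf)
    F' hF').mp inferInstance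

theorem smooth (hAB : IsCrispAlgebra A B) [Algebra.Smooth B (B ⊗[A] R)] : Algebra.Smooth A R :=
  have := hAB.finitePresentation (R := R)
  ⟨hAB.formallySmooth, this⟩

end IsCrispAlgebra

/-- Descent of differential properties of an algebra `R` along a crisp ring homomorphism `A → B`.
The base change of `R` to `B` is written `B ⊗[A] R`, with its left `B`-algebra structure. -/
theorem proposition1p11 {A : Type u} {B : Type v} {R : Type w}
    [CommRing A] [CommRing B] [CommRing R] [Algebra A B] [Algebra A R]
    (hAB : IsCrispAlgebra A B) :
    (Algebra.FormallyUnramified B (B ⊗[A] R) → Algebra.FormallyUnramified A R) ∧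
    (Algebra.Unramified B (B ⊗[A] R) → Algebra.Unramified A R) ∧
    (Algebra.Etale B (B ⊗[A] R) → Algebra.Etale A R) ∧
    (Algebra.Smooth B (B ⊗[A] R) → Algebra.Smooth A R) := by
  refine ⟨fun _ ↦ hAB.formallyUnramified, fun _ ↦ ?_, fun _ ↦ ?_, fun _ ↦ hAB.smooth⟩
  · exact ⟨hAB.formallyUnramified, hAB.finiteType⟩
  · exact Algebra.Etale.iff_formallyUnramified_and_smooth.mpr
      ⟨hAB.formallyUnramified, hAB.smooth⟩
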